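/- Let $V$ be a topological space with its Borel $\sigma$-algebra, $\pi$ a $\sigma$-finite measure on $V$, and $\lambda$ a Lévy measure concentrated on $(0,\infty)$, i.e. $\lambda((-\infty,0])=0$ and $\int (1\wedge z^2)\,\lambda(\mathrm{d}z)<\infty$. Let $\mu$ be a Poisson random measure on $V\times\mathbb{R}\times(0,\infty)$, defined on a probability space $(\Omega,\mathcal{F},\mathbf{P})$, with intensity $\nu(\mathrm{d}x,\mathrm{d}u,\mathrm{d}z)=\pi(\mathrm{d}x)\,\mathrm{d}u\,\lambda(\mathrm{d}z)$, and let $$\Lambda_1(\mathrm{d}x,\mathrm{d}u)=\int_{(0,1]} z\,(\mu-\nu)(\mathrm{d}x,\mathrm{d}u,\mathrm{d}z).$$ Let $f:V\times\mathbb{R}\to[0,\infty)$ be measurable and such that the process $$X_1(t)=\iint_{V\times\mathbb{R}} f(x,t-u)\,\Lambda_1(\mathrm{d}x,\mathrm{d}u)=\iiint_{V\times\mathbb{R}\times(0,1]} f(x,t-u)\,z\,(\mu-\nu)(\mathrm{d}x,\mathrm{d}u,\mathrm{d}z),\qquad t\in\mathbb{R},$$ is well defined. Here a compensated integral $\int H\,\mathrm{d}(\mu-\nu)$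 is well defined if there is a random variable, then denoted $\int H\,\mathrm{d}(\mu-\nu)$, to which $\int H_n\,\mathrm{d}\mu-\int H_n\,\mathrm{d}\nu$ converges in probability for every sequence of bounded measurable functions $H_n$, each vanishing outside a set of finite $\nu$-measure, with $|H_n|\le|H|$ and $H_n\to H$ pointwise. For every $\alpha\in[1,2]$ there exists a constant $C=C_\alpha\in(0,\infty)$ depending only on $\alpha$ (and not on $V,\pi,\lambda,f$ or the probability space) such that for all $y>0$ and $0\le s<t<\infty$ $$ \begin{aligned} &\mathbf{P}\bigl(|X_1(t)-X_1(s)|\wedge|X_1(s)-X_1(0)|>y\bigr)\\ &\le C y^{-2\alpha}\Bigl(\int_{(0,1]}z^\alpha\lambda(\mathrm{d}z)\Bigr)^2 \iint_{V\times\mathbb{R}}|f(x,t-u)-f(x,s-u)|^\alpha\,\pi(\mathrm{d}x)\,\mathrm{d}u\\ &\qquad\times\iint_{V\times\mathbb{R}}|f(x,s-u)-f(x,-u)|^\alpha\,\pi(\mathrm{d}x)\,\mathrm{d}u\\ &\quad+C y^{-\alpha}\int_{(0,1]}z^\alpha\lambda(\mathrm{d}z) \iint_{V\times\mathbb{R}}\bigl(|f(x,t-u)-f(x,s-u)|\wedge|f(x,s-u)-f(x,-u)|\bigr)^\alpha\,\pi(\mathrm{d}x)\,\mathrm{d}u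 . \end{aligned} $$ The integrals on the right-hand side take values in $[0,\infty]$, with $0\cdot\infty=0$. -/

import Mathlib

open MeasureTheory ProbabilityTheory Filter Topology Set
open scoped ENNReal NNReal

/-- `N` is a Poisson random measure on `E` with intensity `ν`, defined on the probability
space `(Ω, P)`: `N(A)` is Poisson distributed with mean `ν(A)` (almost surely infinite if
`ν(A) = ∞`), and the values of `N` on disjoint sets are independent. -/
structure IsPoissonRandomMeasure {Ω E : Type*} [MeasurableSpace Ω] [MeasurableSpace E]
    (P : Measure Ω) (N : Ω → Measure E) (ν : Measure E) : Prop where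
  measurable : ∀ A : Set E, MeasurableSet A → Measurable (fun ω => N ω A)
  law_of_finite : ∀ A : Set E, MeasurableSet A → ν A ≠ ∞ →
    P.map (fun ω => N ω A) = (poissonMeasure (ν A).toNNReal).map (fun k : ℕ => (k : ℝ≥0∞))
  eq_top_of_infinite : ∀ A : Set E, MeasurableSet A → ν A = ∞ → ∀ᵐ ω ∂P, N ω A = ∞
  indep : ∀ (n : ℕ) (A : Fin n → Set E), (∀ i, MeasurableSet (A i)) →
    Pairwise (fun i j => Disjoint (A i) (A j)) →
    iIndepFun (fun i ω => N ω (A i)) P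

/-- The integral of `H` against the compensated measure `N - ν`, for `H` bounded, measurable
and supported on a set of finite `ν`-measure (both integrals are then finite almost surely). -/
noncomputable def elementaryCompensatedIntegral {Ω E : Type*} [MeasurableSpace E]
    (N : Ω → Measure E) (ν : Measure E) (H : E → ℝ) (ω : Ω) : ℝ :=
  ∫ p, H p ∂(N ω) - ∫ p, H p ∂ν

/-- `H_n` is an admissible approximation of `H`: the `H_n` are bounded, measurable, supported on
sets of finite `ν`-measure, dominated by `|H|`, and converge pointwise to `H`. -/
structure IsAdmissibleApprox {E : Type*} [MeasurableSpace E]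
    (ν : Measure E) (H : E → ℝ) (Hn : ℕ → E → ℝ) : Prop where
  measurable : ∀ n, Measurable (Hn n)
  bounded : ∀ n, ∃ K : ℝ, ∀ p, |Hn n p| ≤ K
  finite_support : ∀ n, ν {p | Hn n p ≠ 0} < ∞
  dominated : ∀ n p, |Hn n p| ≤ |H p|
  tendsto : ∀ p, Tendsto (fun n => Hn n p) atTop (𝓝 (H p))

/-- The compensated Poisson integral `∫ H d(N - ν)` exists and is equal to the random variable
`Y`: along every admissible approximation of `H`, the elementary integrals converge to `Y`
in probability. (For a Poisson random measure `N` with `σ`-finite intensity `ν` and measurable `H`,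
such a `Y` exists if and only if `∫ min (H ^ 2) |H| dν < ∞`, and it is then a.s. unique.) -/
structure IsCompensatedIntegral {Ω E : Type*} [MeasurableSpace Ω] [MeasurableSpace E]
    (P : Measure Ω) (N : Ω → Measure E) (ν : Measure E) (H : E → ℝ) (Y : Ω → ℝ) : Prop where
  aemeasurable : AEMeasurable Y P
  tendsto : ∀ Hn : ℕ → E → ℝ, IsAdmissibleApprox ν H Hn →
    TendstoInMeasure P (fun n => elementaryCompensatedIntegral N ν (Hn n)) atTop Y

/-- `lam` is a Lévy measure concentrated on `(0, ∞)`. -/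
structure IsLevyMeasureOnPos (lam : Measure ℝ) : Prop where
  concentrated : lam (Iic 0) = 0
  integrable : ∫⁻ z, ENNReal.ofReal (min 1 (z ^ 2)) ∂lam < ∞

/-- The intensity `ν(dx, du, dz) = π(dx) du λ(dz)` on `V × ℝ × ℝ`. -/
noncomputable def jumpIntensity {V : Type*} [MeasurableSpace V] (pi : Measure V)
    (lam : Measure ℝ) : Measure (V × ℝ × ℝ) :=
  pi.prod ((volume : Measure ℝ).prod lam)

/-- `Y` is the stochastic integral `∫∫ h(x, u) Λ₁(dx, du)`, where
`Λ₁(dx, du) = ∫_{(0,1]} z (μ - ν)(dx, du, dz)` is the compensated small-jump part of the Lévy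
basis, that is, `Y = ∫∫∫_{V × ℝ × (0,1]} h(x, u) z (μ - ν)(dx, du, dz)`. -/
def IsSmallJumpIntegral {Ω V : Type*} [MeasurableSpace Ω] [MeasurableSpace V]
    (P : Measure Ω) (N : Ω → Measure (V × ℝ × ℝ)) (pi : Measure V) (lam : Measure ℝ)
    (h : V → ℝ → ℝ) (Y : Ω → ℝ) : Prop :=
  IsCompensatedIntegral P N (jumpIntensity pi lam)
    (fun p => h p.1 p.2.1 * (Ioc (0 : ℝ) 1).indicator (fun z => z) p.2.2) Y

/-- `X₁` is the (well-defined) small-jump mixed moving average process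
`X₁(t) = ∫∫ f(x, t - u) Λ₁(dx, du)`, `t ∈ ℝ`. -/
def IsSmallJumpMMA {Ω V : Type*} [MeasurableSpace Ω] [MeasurableSpace V]
    (P : Measure Ω) (N : Ω → Measure (V × ℝ × ℝ)) (pi : Measure V) (lam : Measure ℝ)
    (f : V → ℝ → ℝ) (X₁ : ℝ → Ω → ℝ) : Prop :=
  ∀ t : ℝ, IsSmallJumpIntegral P N pi lam (fun x u => f x (t - u)) (X₁ t)

/-! On a simple integrand, the compensated integral is a finite sum `∑ a i * Z i` of independent
compensated Poisson variables with means `m i`. Splitting the coefficients at `|a i| = y` and using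
Chebyshev below, Markov above, gives the tail bound `4 ∑ (|a i| / y) ^ α m i`
(`measure_le_abs_sum_le`).

For two such sums built from the same `Z i`, the indices are split by which of `|a i|`, `|b i|` is
larger. If both sums are at least `2 y` in absolute value, then either both dominant parts are at
least `y`, or one of the dominated parts is. The dominant parts live on disjoint index sets, so they
are independent and give the product term; the dominated parts have coefficients of size `min |a i|
|b i|` and give the second term (`measure_le_min_abs_sum_le`).

For general integrands, the kernels at the three times are rounded down to one fine grid on a common
set of finite intensity. Each rounding is an admissible approximation, so the three integrals
converge in probability, and the grid is chosen so fine that the rounding errors vanish in the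
`α`-integrals. The product form of the intensity then separates the `z`-integral from the kernel
integrals. -/

/-! ### Mean and variance of the Poisson law. -/

section PoissonMoments

open scoped Nat

/-- Cancelling `n` against `n !` and shifting the index gives `E[K g(K)] = r E[g(K + 1)]`, here with
`g = 1`; the second moment uses `g(n) = n`. -/
theorem hasSum_poissonMeasure_mul_id (r : ℝ≥0) :
    HasSum (fun n : ℕ => Real.exp (-r) * r ^ n / (n)! * (n : ℝ)) r := by
  rw [← hasSum_nat_add_iff' 1]
  have h := (hasSum_one_poissonMeasure r).mul_left (r : ℝ)
  simp only [Finset.range_one, Finset.sum_singleton, CharP.cast_eq_zero, mul_zero, sub_zero]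
  convert! h using 1
  · funext n
    rw [Nat.factorial_succ]
    push_cast
    field_simp
    ring
  · simp

theorem hasSum_poissonMeasure_mul_sq (r : ℝ≥0) :
    HasSum (fun n : ℕ => Real.exp (-r) * r ^ n / (n)! * (n : ℝ) ^ 2) ((r : ℝ) * (r + 1)) := by
  rw [← hasSum_nat_add_iff' 1]
  have h := ((hasSum_poissonMeasure_mul_id r).add (hasSum_one_poissonMeasure r)).mul_left (r : ℝ)
  simp only [Finset.range_one, Finset.sum_singleton, CharP.cast_eq_zero, ne_eq,
    OfNat.ofNat_ne_zero, not_false_eq_true, zero_pow, mul_zero, sub_zero]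
  convert! h using 1
  funext n
  rw [Nat.factorial_succ]
  push_cast
  field_simp
  ring

theorem memLp_two_natCast_poissonMeasure (r : ℝ≥0) :
    MemLp (fun n : ℕ => (n : ℝ)) 2 (poissonMeasure r) := by
  rw [memLp_two_iff_integrable_sq .of_discrete, integrable_poissonMeasure_iff]
  simpa using (hasSum_poissonMeasure_mul_sq r).summable

theorem integral_natCast_poissonMeasure (r : ℝ≥0) : ∫ n : ℕ, (n : ℝ) ∂(poissonMeasure r) = r := by
  rw [integral_poissonMeasure]
  simpa using (hasSum_poissonMeasure_mul_id r).tsum_eq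

theorem variance_natCast_poissonMeasure (r : ℝ≥0) :
    variance (fun n : ℕ => (n : ℝ)) (poissonMeasure r) = r := by
  rw [variance_eq_sub (memLp_two_natCast_poissonMeasure r), integral_natCast_poissonMeasure]
  have : ∫ n : ℕ, (n : ℝ) ^ 2 ∂(poissonMeasure r) = (r : ℝ) * (r + 1) := by
    rw [integral_poissonMeasure]
    simpa using (hasSum_poissonMeasure_mul_sq r).tsum_eq
  simp only [Pi.pow_apply, this]
  ring

end PoissonMoments

/-! ### Tail bounds for finite sums of compensated Poisson variables. -/

/-- Independent centred square-integrable variables `Z i` with `Var (Z i) = m i` and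
`E |Z i| ≤ 2 m i`, as satisfied by compensated Poisson variables with means `m i`. -/
structure IsCenteredPoissonLike {Ω ι : Type*} [MeasurableSpace Ω] (P : Measure Ω)
    (Z : ι → Ω → ℝ) (m : ι → ℝ) : Prop where
  measurable : ∀ i, Measurable (Z i)
  memLp : ∀ i, MemLp (Z i) 2 P
  integral_eq : ∀ i, ∫ ω, Z i ω ∂P = 0
  variance_eq : ∀ i, variance (Z i) P = m i
  integral_abs_le : ∀ i, ∫ ω, |Z i ω| ∂P ≤ 2 * m i
  indep : iIndepFun Z P

namespace IsCenteredPoissonLike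

variable {Ω ι : Type*} [MeasurableSpace Ω] {P : Measure Ω}
  {Z : ι → Ω → ℝ} {m : ι → ℝ}

theorem nonneg (h : IsCenteredPoissonLike P Z m) (i : ι) : 0 ≤ m i := by
  rw [← h.variance_eq i]
  exact variance_nonneg _ _

theorem indepFun_sum_sum (h : IsCenteredPoissonLike P Z m) {s t : Finset ι} (hst : Disjoint s t)
    (a b : ι → ℝ) :
    IndepFun (fun ω => ∑ i ∈ s, a i * Z i ω) (fun ω => ∑ i ∈ t, b i * Z i ω) P := by
  have := (h.indep.indepFun_finset s t hst h.measurable).comp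
    (φ := fun x : s → ℝ => ∑ i : s, a i * x i) (ψ := fun x : t → ℝ => ∑ i : t, b i * x i)
    (by fun_prop) (by fun_prop)
  convert this using 1
  · ext ω
    exact (Finset.sum_coe_sort s fun i => a i * Z i ω).symm
  · ext ω
    exact (Finset.sum_coe_sort t fun i => b i * Z i ω).symm

variable [IsProbabilityMeasure P]

/-- Chebyshev's inequality; independence makes the variances add. This is the case `α = 2`. -/
theorem measure_le_abs_sum_le_of_sq (h : IsCenteredPoissonLike P Z m) (s : Finset ι) (a : ι → ℝ)
    {c : ℝ} (hc : 0 < c) :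
    P {ω | c ≤ |∑ i ∈ s, a i * Z i ω|} ≤ ENNReal.ofReal (∑ i ∈ s, (|a i| / c) ^ 2 * m i) := by
  have hL : ∀ i, MemLp (fun ω => a i * Z i ω) 2 P := fun i => (h.memLp i).const_mul (a i)
  have hS : MemLp (fun ω => ∑ i ∈ s, a i * Z i ω) 2 P := memLp_finsetSum s fun i _ => hL i
  have h0 : ∫ ω, ∑ i ∈ s, a i * Z i ω ∂P = 0 := by
    rw [integral_finsetSum s fun i _ => (hL i).integrable (by norm_num)]
    simp [integral_const_mul, h.integral_eq]
  have hv : variance (fun ω => ∑ i ∈ s, a i * Z i ω) P = ∑ i ∈ s, a i ^ 2 * m i := by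
    have := IndepFun.variance_sum (μ := P) (s := s) (X := fun i ω => a i * Z i ω)
      (fun i _ => hL i) (fun i _ j _ hij =>
        (h.indep.indepFun hij).comp (measurable_const_mul (a i)) (measurable_const_mul (a j)))
    rw [show (fun ω => ∑ i ∈ s, a i * Z i ω) = ∑ i ∈ s, fun ω => a i * Z i ω by
      ext; simp, this]
    exact Finset.sum_congr rfl fun i _ => by rw [variance_const_mul, h.variance_eq]
  have := meas_ge_le_variance_div_sq hS hc
  rw [h0, hv] at this
  simp only [sub_zero] at this
  refine this.trans (ENNReal.ofReal_le_ofReal (le_of_eq ?_))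
  rw [Finset.sum_div]
  exact Finset.sum_congr rfl fun i _ => by rw [div_pow, sq_abs]; ring

/-- Markov's inequality and the triangle inequality in `L¹`, without independence. This is the case
`α = 1`. -/
theorem measure_le_abs_sum_le_of_abs (h : IsCenteredPoissonLike P Z m) (s : Finset ι) (a : ι → ℝ)
    {c : ℝ} (hc : 0 < c) :
    P {ω | c ≤ |∑ i ∈ s, a i * Z i ω|} ≤ ENNReal.ofReal (2 * ∑ i ∈ s, |a i| / c * m i) := by
  have hL : ∀ i, Integrable (fun ω => a i * Z i ω) P := fun i =>
    ((h.memLp i).integrable (by norm_num)).const_mul (a i)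
  have hS : Integrable (fun ω => ∑ i ∈ s, a i * Z i ω) P := integrable_finsetSum s fun i _ => hL i
  have h1 : ∫ ω, |∑ i ∈ s, a i * Z i ω| ∂P ≤ ∑ i ∈ s, |a i| * (2 * m i) := by
    calc ∫ ω, |∑ i ∈ s, a i * Z i ω| ∂P ≤ ∫ ω, ∑ i ∈ s, |a i * Z i ω| ∂P :=
          integral_mono hS.abs (integrable_finsetSum s fun i _ => (hL i).abs)
            fun ω => Finset.abs_sum_le_sum_abs _ _
      _ = ∑ i ∈ s, |a i| * ∫ ω, |Z i ω| ∂P := by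
          rw [integral_finsetSum s fun i _ => (hL i).abs]
          simp [abs_mul, integral_const_mul]
      _ ≤ _ := Finset.sum_le_sum fun i _ =>
          mul_le_mul_of_nonneg_left (h.integral_abs_le i) (abs_nonneg _)
  have h2 := mul_meas_ge_le_integral_of_nonneg (ae_of_all P fun ω => abs_nonneg _) hS.abs c
  rw [← ENNReal.ofReal_toReal (measure_ne_top P {ω | c ≤ |∑ i ∈ s, a i * Z i ω|})]
  refine ENNReal.ofReal_le_ofReal ?_
  have h3 : c * (P {ω | c ≤ |∑ i ∈ s, a i * Z i ω|}).toReal ≤ ∑ i ∈ s, |a i| * (2 * m i) :=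
    h2.trans h1
  rw [mul_comm, ← le_div_iff₀ hc] at h3
  refine h3.trans (le_of_eq ?_)
  rw [Finset.sum_div, Finset.mul_sum]
  exact Finset.sum_congr rfl fun i _ => by ring

/-- With `x = |a i| / y`, one has `x ^ 2 ≤ x ^ α` for `x ≤ 1` and `x ≤ x ^ α` for `x ≥ 1`, so the
second-moment bound serves small coefficients and the first-moment bound large ones. -/
theorem measure_le_abs_sum_le (h : IsCenteredPoissonLike P Z m) {α : ℝ} (hα : α ∈ Icc (1 : ℝ) 2)
    (s : Finset ι) (a : ι → ℝ) {y : ℝ} (hy : 0 < y) :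
    P {ω | y ≤ |∑ i ∈ s, a i * Z i ω|} ≤
      ENNReal.ofReal (4 * ∑ i ∈ s, (|a i| / y) ^ α * m i) := by
  classical
  set p : ι → Prop := fun i => |a i| ≤ y
  have hsub : {ω | y ≤ |∑ i ∈ s, a i * Z i ω|} ⊆
      {ω | y / 2 ≤ |∑ i ∈ s with p i, a i * Z i ω|} ∪
      {ω | y / 2 ≤ |∑ i ∈ s with ¬ p i, a i * Z i ω|} := by
    intro ω hω
    simp only [mem_ofPred_eq, mem_union] at hω ⊢
    by_contra! hcon
    rw [← Finset.sum_filter_add_sum_filter_not s p] at hω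
    linarith [abs_add_le (∑ i ∈ s with p i, a i * Z i ω) (∑ i ∈ s with ¬ p i, a i * Z i ω)]
  -- Each part gets the threshold `y / 2`. This costs `2 ^ 2` in Chebyshev and `2 * 2` in Markov,
  -- hence the common constant `4`.
  have hy2 : 0 < y / 2 := by positivity
  have h0 : ∀ i, 0 ≤ |a i| / y := fun i => by positivity
  refine (measure_mono hsub).trans ((measure_union_le _ _).trans ?_)
  rw [← Finset.sum_filter_add_sum_filter_not s p, mul_add,
    ENNReal.ofReal_add (mul_nonneg (by norm_num) (Finset.sum_nonneg fun i _ =>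
      mul_nonneg (Real.rpow_nonneg (h0 i) _) (h.nonneg i)))
      (mul_nonneg (by norm_num) (Finset.sum_nonneg fun i _ =>
      mul_nonneg (Real.rpow_nonneg (h0 i) _) (h.nonneg i)))]
  refine add_le_add ?_ ?_
  · refine (h.measure_le_abs_sum_le_of_sq _ a hy2).trans (ENNReal.ofReal_le_ofReal ?_)
    rw [Finset.mul_sum]
    refine Finset.sum_le_sum fun i hi => ?_
    have hi : |a i| / y ≤ 1 := (div_le_one hy).2 (Finset.mem_filter.1 hi).2
    have := Real.rpow_le_rpow_of_exponent_ge' (h0 i) hi (zero_le_one.trans hα.1) hα.2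
    rw [Real.rpow_two] at this
    calc (|a i| / (y / 2)) ^ 2 * m i = 4 * ((|a i| / y) ^ 2 * m i) := by field_simp; ring
      _ ≤ _ := by gcongr; exact h.nonneg i
  · refine (h.measure_le_abs_sum_le_of_abs _ a hy2).trans (ENNReal.ofReal_le_ofReal ?_)
    rw [Finset.mul_sum, Finset.mul_sum]
    refine Finset.sum_le_sum fun i hi => ?_
    have hi : 1 ≤ |a i| / y := (one_le_div hy).2 (not_le.1 (Finset.mem_filter.1 hi).2).le
    have := Real.rpow_le_rpow_of_exponent_le hi hα.1
    rw [Real.rpow_one] at this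
    calc 2 * (|a i| / (y / 2) * m i) = 4 * (|a i| / y * m i) := by field_simp; ring
      _ ≤ _ := by gcongr; exact h.nonneg i

/-- The larger coefficients of the two sums occupy disjoint index sets, so the corresponding partial
sums are independent; what remains has coefficients `min |a i| |b i|`. -/
theorem measure_le_min_abs_sum_le (h : IsCenteredPoissonLike P Z m) {α : ℝ}
    (hα : α ∈ Icc (1 : ℝ) 2) (s : Finset ι) (a b : ι → ℝ) {y : ℝ} (hy : 0 < y) :
    P {ω | 2 * y ≤ min |∑ i ∈ s, a i * Z i ω| |∑ i ∈ s, b i * Z i ω|} ≤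
      ENNReal.ofReal (4 * ∑ i ∈ s, (|a i| / y) ^ α * m i) *
        ENNReal.ofReal (4 * ∑ i ∈ s, (|b i| / y) ^ α * m i) +
      ENNReal.ofReal (4 * ∑ i ∈ s, (min |a i| |b i| / y) ^ α * m i) := by
  classical
  set p : ι → Prop := fun i => |a i| ≤ |b i|
  have hsub : {ω | 2 * y ≤ min |∑ i ∈ s, a i * Z i ω| |∑ i ∈ s, b i * Z i ω|} ⊆
      ({ω | y ≤ |∑ i ∈ s with ¬ p i, a i * Z i ω|} ∩ {ω | y ≤ |∑ i ∈ s with p i, b i * Z i ω|}) ∪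
      ({ω | y ≤ |∑ i ∈ s with p i, a i * Z i ω|} ∪
        {ω | y ≤ |∑ i ∈ s with ¬ p i, b i * Z i ω|}) := by
    intro ω hω
    simp only [mem_ofPred_eq, mem_union, mem_inter_iff, le_min_iff] at hω ⊢
    by_contra! hcon
    rw [← Finset.sum_filter_add_sum_filter_not s p, ← Finset.sum_filter_add_sum_filter_not s p
      (fun i => b i * Z i ω)] at hω
    have h1 := abs_add_le (∑ i ∈ s with p i, a i * Z i ω) (∑ i ∈ s with ¬ p i, a i * Z i ω)
    have h2 := abs_add_le (∑ i ∈ s with p i, b i * Z i ω) (∑ i ∈ s with ¬ p i, b i * Z i ω)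
    by_cases h3 : y ≤ |∑ i ∈ s with ¬ p i, a i * Z i ω|
    · linarith [hcon.1 h3, hω.2]
    · linarith [hω.1]
  have h0 : ∀ c : ι → ℝ, ∀ i, 0 ≤ |c i| / y := fun c i => by positivity
  have hterm : ∀ c : ι → ℝ, ∀ i, 0 ≤ (|c i| / y) ^ α * m i := fun c i =>
    mul_nonneg (Real.rpow_nonneg (h0 c i) _) (h.nonneg i)
  have hmono : ∀ c : ι → ℝ, ∀ q : ι → Prop, [DecidablePred q] →
      P {ω | y ≤ |∑ i ∈ s with q i, c i * Z i ω|} ≤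
        ENNReal.ofReal (4 * ∑ i ∈ s, (|c i| / y) ^ α * m i) := fun c q _ =>
    (h.measure_le_abs_sum_le hα _ c hy).trans (ENNReal.ofReal_le_ofReal
      (mul_le_mul_of_nonneg_left (Finset.sum_le_sum_of_subset_of_nonneg (Finset.filter_subset _ _)
        fun i _ _ => hterm c i) (by norm_num)))
  -- The first goal concerns the independent dominant parts. In the second, the two dominated sums
  -- recombine into a single sum over `s`, so the constant stays `4`.
  refine (measure_mono hsub).trans ((measure_union_le _ _).trans (add_le_add ?_ ?_))
  · have hind := (h.indepFun_sum_sum (Finset.disjoint_filter_filter_not s s p).symm a b)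
    have hA : MeasurableSet {x : ℝ | y ≤ |x|} :=
      measurableSet_le measurable_const (measurable_id.abs)
    have := hind.measure_inter_preimage_eq_mul _ _ hA hA
    simp only [preimage_ofPred_eq] at this
    rw [this]
    exact mul_le_mul' (hmono a _) (hmono b _)
  · refine (measure_union_le _ _).trans ((add_le_add (h.measure_le_abs_sum_le hα _ a hy)
      (h.measure_le_abs_sum_le hα _ b hy)).trans (le_of_eq ?_))
    rw [← ENNReal.ofReal_add (mul_nonneg (by norm_num) (Finset.sum_nonneg fun i _ => hterm a i))
      (mul_nonneg (by norm_num) (Finset.sum_nonneg fun i _ => hterm b i)), ← mul_add,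
      ← Finset.sum_filter_add_sum_filter_not s p
        (fun i => (min |a i| |b i| / y) ^ α * m i)]
    congr 3 <;> refine Finset.sum_congr rfl fun i hi => ?_
    · rw [min_eq_left (Finset.mem_filter.1 hi).2]
    · rw [min_eq_right (not_le.1 (Finset.mem_filter.1 hi).2).le]

end IsCenteredPoissonLike

/-! ### Poisson counts of disjoint sets. -/

namespace IsPoissonRandomMeasure

variable {Ω E : Type*} [MeasurableSpace Ω] [MeasurableSpace E] {P : Measure Ω}
  {N : Ω → Measure E} {ν : Measure E}

theorem identDistrib_real (hN : IsPoissonRandomMeasure P N ν) {A : Set E} (hA : MeasurableSet A)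
    (hνA : ν A ≠ ∞) :
    IdentDistrib (fun ω => (N ω).real A) (fun n : ℕ => (n : ℝ)) P
      (poissonMeasure (ν A).toNNReal) where
  aemeasurable_fst := (hN.measurable A hA).ennreal_toReal.aemeasurable
  aemeasurable_snd := .of_discrete
  map_eq := by
    have h1 : P.map (fun ω => (N ω).real A) = (P.map fun ω => N ω A).map ENNReal.toReal := by
      rw [Measure.map_map ENNReal.measurable_toReal (hN.measurable A hA)]
      rfl
    rw [h1, hN.law_of_finite A hA hνA, Measure.map_map ENNReal.measurable_toReal .of_discrete]
    congr 1

theorem ae_ne_top (hN : IsPoissonRandomMeasure P N ν) {A : Set E} (hA : MeasurableSet A)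
    (hνA : ν A ≠ ∞) : ∀ᵐ ω ∂P, N ω A ≠ ∞ := by
  have h : ∀ᵐ x ∂(P.map fun ω => N ω A), x ≠ ∞ := by
    rw [hN.law_of_finite A hA hνA]
    exact (ae_map_iff .of_discrete (measurableSet_singleton (∞ : ℝ≥0∞)).compl).2 (by simp)
  exact ae_of_ae_map (hN.measurable A hA).aemeasurable h

theorem isCenteredPoissonLike [IsProbabilityMeasure P] (hN : IsPoissonRandomMeasure P N ν)
    {ι : Type*} [Fintype ι]
    {A : ι → Set E} (hA : ∀ i, MeasurableSet (A i)) (hνA : ∀ i, ν (A i) ≠ ∞)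
    (hdisj : Pairwise fun i j => Disjoint (A i) (A j)) :
    IsCenteredPoissonLike P (fun i ω => (N ω).real (A i) - ν.real (A i))
      (fun i => ν.real (A i)) := by
  have hid := fun i => hN.identDistrib_real (hA i) (hνA i)
  have hmeas : ∀ i, Measurable fun ω => (N ω).real (A i) := fun i =>
    (hN.measurable _ (hA i)).ennreal_toReal
  have hL : ∀ i, MemLp (fun ω => (N ω).real (A i)) 2 P := fun i =>
    (hid i).memLp_iff.2 (memLp_two_natCast_poissonMeasure _)
  have hI : ∀ i, Integrable (fun ω => (N ω).real (A i)) P := fun i =>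
    (hL i).integrable (by norm_num)
  have hE : ∀ i, ∫ ω, (N ω).real (A i) ∂P = ν.real (A i) := fun i => by
    rw [(hid i).integral_eq, integral_natCast_poissonMeasure]
    rfl
  refine ⟨fun i => (hmeas i).sub_const _, fun i => (hL i).sub (memLp_const _), fun i => ?_,
    fun i => ?_, fun i => ?_, ?_⟩
  · rw [integral_sub (hI i) (integrable_const _), hE]
    simp
  · rw [variance_sub_const (hL i).1, (hid i).variance_eq, variance_natCast_poissonMeasure]
    rfl
  · calc ∫ ω, |(N ω).real (A i) - ν.real (A i)| ∂P
        ≤ ∫ ω, ((N ω).real (A i) + ν.real (A i)) ∂P := by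
          refine integral_mono ((hI i).sub (integrable_const _)).abs
            ((hI i).add (integrable_const _)) fun ω => ?_
          refine (abs_sub _ _).trans (le_of_eq ?_)
          rw [abs_of_nonneg measureReal_nonneg, abs_of_nonneg measureReal_nonneg]
      _ = 2 * ν.real (A i) := by
          rw [integral_add (hI i) (integrable_const _), hE]
          simp [two_mul]
  -- Independence is postulated for families indexed by `Fin n` and is transported along an
  -- enumeration of `ι`.
  · let e := Fintype.equivFin ι
    have h1 := hN.indep _ (fun k => A (e.symm k)) (fun k => hA _)
      fun j k hjk => hdisj fun h => hjk (e.symm.injective h)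
    have h2 := (h1.precomp e.injective).comp (fun i x => x.toReal - ν.real (A i))
      fun i => ENNReal.measurable_toReal.sub_const _
    simp only [Function.comp_def, e, Equiv.symm_apply_apply] at h2
    exact h2

end IsPoissonRandomMeasure

/-! ### Integrals of functions of a simple function as sums over its nonzero values. -/

section SimpleFunctions

open scoped Classical in
theorem MeasureTheory.SimpleFunc.integral_comp_eq_sum {E F : Type*} [MeasurableSpace E] [NormedAddCommGroup F]
    (S : SimpleFunc E F) {μ : Measure E} (hS : ∀ c ≠ 0, μ (S ⁻¹' {c}) ≠ ∞) {g : F → ℝ}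
    (hg : g 0 = 0) :
    ∫ p, g (S p) ∂μ = ∑ c ∈ S.range with c ≠ 0, g c * μ.real (S ⁻¹' {c}) := by
  have hint : Integrable S μ := SimpleFunc.integrable_iff.2 fun c hc => (hS c hc).lt_top
  have hgS : Integrable (S.map g) μ := by
    refine SimpleFunc.integrable_iff_finMeasSupp.2 ?_
    exact (SimpleFunc.integrable_iff_finMeasSupp.1 hint).map hg
  have h1 := SimpleFunc.integral_eq_integral (S.map g) hgS
  rw [SimpleFunc.map_integral S g hint hg] at h1
  rw [show ∫ p, g (S p) ∂μ = ∫ p, (S.map g) p ∂μ from rfl, ← h1, Finset.sum_filter]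
  refine Finset.sum_congr rfl fun c _ => ?_
  split_ifs with h
  · rw [smul_eq_mul, mul_comm]
  · rw [not_not.1 h, hg, smul_zero]

open scoped Classical in
theorem MeasureTheory.SimpleFunc.ofReal_sum_eq_lintegral_comp {E F : Type*} [MeasurableSpace E] [Zero F]
    (S : SimpleFunc E F) {μ : Measure E} (hS : ∀ c ≠ 0, μ (S ⁻¹' {c}) ≠ ∞) {g : F → ℝ}
    (hg : g 0 = 0) (hg0 : ∀ c, 0 ≤ g c) :
    ENNReal.ofReal (∑ c ∈ S.range with c ≠ 0, g c * μ.real (S ⁻¹' {c})) =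
      ∫⁻ p, ENNReal.ofReal (g (S p)) ∂μ := by
  have h1 := SimpleFunc.map_lintegral (μ := μ) (fun c => ENNReal.ofReal (g c)) S
  rw [← SimpleFunc.lintegral_eq_lintegral] at h1
  rw [show ∫⁻ p, ENNReal.ofReal (g (S p)) ∂μ =
    ∫⁻ p, (S.map fun c => ENNReal.ofReal (g c)) p ∂μ from rfl, h1,
    ENNReal.ofReal_sum_of_nonneg fun c _ => mul_nonneg (hg0 c) measureReal_nonneg,
    Finset.sum_filter]
  refine Finset.sum_congr rfl fun c _ => ?_
  split_ifs with h
  · rw [ENNReal.ofReal_mul (hg0 c), ofReal_measureReal (hS c h)]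
  · rw [not_not.1 h, hg, ENNReal.ofReal_zero, zero_mul]

end SimpleFunctions

/-! ### The two-sum bound for simple integrands. -/

namespace IsPoissonRandomMeasure

variable {Ω E F : Type*} [MeasurableSpace Ω] [MeasurableSpace E] [NormedAddCommGroup F]
  {P : Measure Ω} {N : Ω → Measure E} {ν : Measure E}

-- Almost surely all fibres over nonzero values have finite `N ω`-measure, so neither Bochner
-- integral falls back to its default value `0`. The zero fibre may have infinite measure but
-- carries no weight because `g 0 = 0`.
open scoped Classical in
theorem elementaryCompensatedIntegral_comp_ae_eq (hN : IsPoissonRandomMeasure P N ν)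
    (S : SimpleFunc E F) (hS : ∀ c ≠ 0, ν (S ⁻¹' {c}) ≠ ∞) {g : F → ℝ} (hg : g 0 = 0) :
    elementaryCompensatedIntegral N ν (fun p => g (S p)) =ᵐ[P] fun ω =>
      ∑ c ∈ S.range with c ≠ 0, g c * ((N ω).real (S ⁻¹' {c}) - ν.real (S ⁻¹' {c})) := by
  have h : ∀ᵐ ω ∂P, ∀ c ∈ S.range, c ≠ 0 → N ω (S ⁻¹' {c}) ≠ ∞ := by
    rw [Filter.eventually_all_finset]
    intro c _
    by_cases hc : c = 0
    · simp [hc]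
    · filter_upwards [hN.ae_ne_top (S.measurableSet_fiber c) (hS c hc)] with ω hω _ using hω
  filter_upwards [h] with ω hω
  have h' : ∀ c ≠ 0, N ω (S ⁻¹' {c}) ≠ ∞ := fun c hc => by
    by_cases hr : c ∈ S.range
    · exact hω c hr hc
    · have : S ⁻¹' {c} = ∅ := by
        ext p
        simp only [mem_preimage, mem_singleton_iff, mem_empty_iff_false, iff_false]
        rintro rfl
        exact hr (SimpleFunc.mem_range_self S p)
      simp [this]
  rw [elementaryCompensatedIntegral, SimpleFunc.integral_comp_eq_sum S h' hg,
    SimpleFunc.integral_comp_eq_sum S hS hg, ← Finset.sum_sub_distrib]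
  exact Finset.sum_congr rfl fun c _ => (mul_sub _ _ _).symm

theorem measure_le_min_abs_elementary_le [IsProbabilityMeasure P]
    (hN : IsPoissonRandomMeasure P N ν)
    (S : SimpleFunc E F) (hS : ∀ c ≠ 0, ν (S ⁻¹' {c}) ≠ ∞) {g h : F → ℝ} (hg : g 0 = 0)
    (hh : h 0 = 0) {α : ℝ} (hα : α ∈ Icc (1 : ℝ) 2) {y : ℝ} (hy : 0 < y) :
    P {ω | 2 * y ≤ min |elementaryCompensatedIntegral N ν (fun p => g (S p)) ω|
        |elementaryCompensatedIntegral N ν (fun p => h (S p)) ω|} ≤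
      (4 * ∫⁻ p, ENNReal.ofReal ((|g (S p)| / y) ^ α) ∂ν) *
        (4 * ∫⁻ p, ENNReal.ofReal ((|h (S p)| / y) ^ α) ∂ν) +
      4 * ∫⁻ p, ENNReal.ofReal ((min |g (S p)| |h (S p)| / y) ^ α) ∂ν := by
  classical
  let s : Finset F := {c ∈ S.range | c ≠ 0}
  have hs : ∀ c : s, (c : F) ≠ 0 := fun c => (Finset.mem_filter.1 c.2).2
  have hZ := hN.isCenteredPoissonLike (A := fun c : s => S ⁻¹' {(c : F)})
    (fun c => S.measurableSet_fiber _) (fun c => hS _ (hs c)) fun c d hcd =>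
      Disjoint.preimage _ (disjoint_singleton.2 fun h => hcd (Subtype.ext h))
  have hα0 : α ≠ 0 := by linarith [hα.1]
  have key := hZ.measure_le_min_abs_sum_le hα Finset.univ (fun c => g c) (fun c => h c) hy
  have hconv : ∀ k : F → ℝ, k 0 = 0 → (∀ c, 0 ≤ k c) →
      ENNReal.ofReal (4 * ∑ c : s, (k c / y) ^ α * ν.real (S ⁻¹' {(c : F)})) =
        4 * ∫⁻ p, ENNReal.ofReal ((k (S p) / y) ^ α) ∂ν := by
    intro k hk hk0
    rw [← SimpleFunc.ofReal_sum_eq_lintegral_comp (g := fun c => (k c / y) ^ α) S hS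
      (by simp [hk, hα0]) (fun c => Real.rpow_nonneg (div_nonneg (hk0 c) hy.le) _),
      ENNReal.ofReal_mul (by norm_num), ENNReal.ofReal_ofNat,
      Finset.sum_coe_sort s fun c => (k c / y) ^ α * ν.real (S ⁻¹' {c})]
  rw [hconv (fun c => |g c|) (by simp [hg]) fun c => abs_nonneg _,
    hconv (fun c => |h c|) (by simp [hh]) fun c => abs_nonneg _,
    hconv (fun c => min |g c| |h c|) (by simp [hg, hh]) fun c => by positivity] at key
  refine le_trans (le_of_eq (measure_congr ?_)) key
  filter_upwards [hN.elementaryCompensatedIntegral_comp_ae_eq S hS hg,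
    hN.elementaryCompensatedIntegral_comp_ae_eq S hS hh] with ω h1 h2
  refine propext ?_
  change 2 * y ≤ _ ↔ 2 * y ≤ _
  rw [h1, h2, ← Finset.sum_coe_sort s fun c => g c * ((N ω).real (S ⁻¹' {c}) - ν.real (S ⁻¹' {c})),
    ← Finset.sum_coe_sort s fun c => h c * ((N ω).real (S ⁻¹' {c}) - ν.real (S ⁻¹' {c}))]

end IsPoissonRandomMeasure

/-! ### Rounding down to a grid, as an admissible approximation. -/

section Quantization

/-- The largest multiple of `1 / k` not exceeding `a`. -/
noncomputable def quantize (k : ℕ) (a : ℝ) : ℝ := ⌊k * a⌋₊ / k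

theorem quantize_nonneg (k : ℕ) (a : ℝ) : 0 ≤ quantize k a := by
  unfold quantize; positivity

theorem quantize_le {k : ℕ} (hk : 0 < k) {a : ℝ} (ha : 0 ≤ a) : quantize k a ≤ a := by
  have hk' : (0 : ℝ) < k := Nat.cast_pos.2 hk
  rw [quantize, div_le_iff₀ hk', mul_comm a]
  exact Nat.floor_le (by positivity)

theorem sub_le_quantize {k : ℕ} (hk : 0 < k) (a : ℝ) : a - 1 / k ≤ quantize k a := by
  have hk' : (0 : ℝ) < k := Nat.cast_pos.2 hk
  rw [quantize, le_div_iff₀ hk', sub_mul, one_div, inv_mul_cancel₀ hk'.ne', mul_comm a]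
  linarith [Nat.lt_floor_add_one ((k : ℝ) * a)]

theorem measurable_quantize (k : ℕ) : Measurable (quantize k) :=
  ((measurable_from_top (f := fun n : ℕ => (n : ℝ))).comp
    (Nat.measurable_floor.comp (measurable_const_mul (k : ℝ)))).div_const _

theorem abs_quantize_sub_quantize_le {k : ℕ} (hk : 0 < k) {a b : ℝ} (ha : 0 ≤ a) (hb : 0 ≤ b) :
    |quantize k a - quantize k b| ≤ |a - b| + 1 / k := by
  have h1 := quantize_le hk ha
  have h2 := quantize_le hk hb
  have h3 := sub_le_quantize hk a
  have h4 := sub_le_quantize hk b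
  rw [abs_le]
  constructor <;> linarith [le_abs_self (a - b), neg_abs_le (a - b)]

variable {E : Type*} [MeasurableSpace E]

/-- The simple function equal to `quantize k ∘ H` on `B` and to `0` elsewhere, for `H ≤ M` on
`B`. -/
noncomputable def quantizeSimpleFunc (k M : ℕ) {H : E → ℝ} (hH : Measurable H) {B : Set E}
    (hB : MeasurableSet B) (hHB : ∀ p ∈ B, H p ≤ M) : SimpleFunc E ℝ where
  toFun := B.indicator fun p => quantize k (H p)
  measurableSet_fiber' c :=
    (((measurable_quantize k).comp hH).indicator hB) (measurableSet_singleton c)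
  finite_range' := by
    refine ((finite_Iic (k * M)).image fun j : ℕ => (j : ℝ) / k).subset ?_
    rintro _ ⟨p, rfl⟩
    by_cases hp : p ∈ B
    · rw [indicator_of_mem hp]
      refine ⟨⌊k * H p⌋₊, Nat.floor_le_of_le ?_, rfl⟩
      push_cast
      exact mul_le_mul_of_nonneg_left (hHB p hp) (Nat.cast_nonneg _)
    · rw [indicator_of_notMem hp]
      exact ⟨0, by simp, by simp⟩

theorem isAdmissibleApprox_indicator_quantize {ν : Measure E} {H : E → ℝ} (hH : Measurable H)
    (hH0 : ∀ p, 0 ≤ H p) {B : ℕ → Set E} (hB : ∀ n, MeasurableSet (B n))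
    (hνB : ∀ n, ν (B n) < ∞) (hBH : ∀ n, ∀ p ∈ B n, H p ≤ n)
    (hBev : ∀ p, ∀ᶠ n in atTop, p ∈ B n) {k : ℕ → ℕ} (hk0 : ∀ n, 0 < k n)
    (hk : Tendsto k atTop atTop) :
    IsAdmissibleApprox ν H fun n => (B n).indicator fun p => quantize (k n) (H p) where
  measurable n := ((measurable_quantize _).comp hH).indicator (hB n)
  bounded n := by
    refine ⟨n, fun p => ?_⟩
    by_cases hp : p ∈ B n
    · rw [indicator_of_mem hp, abs_of_nonneg (quantize_nonneg _ _)]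
      exact (quantize_le (hk0 n) (hH0 p)).trans (hBH n p hp)
    · simp [indicator_of_notMem hp]
  finite_support n := by
    refine (measure_mono fun p hp => ?_).trans_lt (hνB n)
    by_contra h
    exact hp (indicator_of_notMem h _)
  dominated n p := by
    by_cases hp : p ∈ B n
    · rw [indicator_of_mem hp, abs_of_nonneg (quantize_nonneg _ _), abs_of_nonneg (hH0 p)]
      exact quantize_le (hk0 n) (hH0 p)
    · simp [indicator_of_notMem hp]
  tendsto p := by
    have h1 : Tendsto (fun n => H p - 1 / (k n : ℝ)) atTop (𝓝 (H p)) := by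
      simpa using (tendsto_const_nhds (x := H p)).sub
        (tendsto_one_div_atTop_nhds_zero_nat.comp hk)
    have h2 : Tendsto (fun n => quantize (k n) (H p)) atTop (𝓝 (H p)) :=
      tendsto_of_tendsto_of_tendsto_of_le_of_le h1 tendsto_const_nhds
        (fun n => sub_le_quantize (hk0 n) _) fun n => quantize_le (hk0 n) (hH0 p)
    refine h2.congr' ?_
    filter_upwards [hBev p] with n hn
    exact (indicator_of_mem hn fun p => quantize (k n) (H p)).symm

/-- The last property makes the total rounding error, mesh times `ν (B n)`, vanish even though `ν (B
n)` may tend to infinity. -/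
theorem exists_quantization_scale (ν : Measure E) [SigmaFinite ν] {H : E → ℝ}
    (hH : Measurable H) :
    ∃ (B : ℕ → Set E) (k : ℕ → ℕ), (∀ n, MeasurableSet (B n)) ∧ (∀ n, ν (B n) < ∞) ∧
      (∀ n, ∀ p ∈ B n, H p ≤ n) ∧ (∀ p, ∀ᶠ n in atTop, p ∈ B n) ∧ (∀ n, 0 < k n) ∧
      Tendsto k atTop atTop ∧
      Tendsto (fun n => ENNReal.ofReal (1 / k n) * ν (B n)) atTop (𝓝 0) := by
  have hfin : ∀ n : ℕ, ν (spanningSets ν n ∩ {p | H p ≤ n}) < ∞ := fun n =>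
    (measure_mono inter_subset_left).trans_lt (measure_spanningSets_lt_top ν n)
  -- In `k n`, the factor `n + 1` forces divergence and the other factor exceeds `ν (B n)`, so `ν (B
  -- n) / k n ≤ 1 / (n + 1)`.
  refine ⟨fun n => spanningSets ν n ∩ {p | H p ≤ n},
    fun n => (n + 1) * (⌈ν.real (spanningSets ν n ∩ {p | H p ≤ n})⌉₊ + 1),
    fun n => (measurableSet_spanningSets ν n).inter (measurableSet_le hH measurable_const),
    hfin, fun n p hp => hp.2, fun p => ?_, fun n => by positivity, ?_, ?_⟩
  · filter_upwards [eventually_ge_atTop (spanningSetsIndex ν p), eventually_ge_atTop ⌈H p⌉₊]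
      with n h1 h2
    exact ⟨mem_spanningSets_of_index_le ν p h1, (Nat.le_ceil _).trans (Nat.cast_le.2 h2)⟩
  · refine tendsto_atTop_mono (fun n => ?_) tendsto_id
    exact (Nat.le_succ n).trans (Nat.le_mul_of_pos_right _ (Nat.succ_pos _))
  · have h0 : Tendsto (fun n : ℕ => ENNReal.ofReal (1 / ((n : ℝ) + 1))) atTop (𝓝 0) := by
      simpa using ENNReal.tendsto_ofReal (tendsto_one_div_add_atTop_nhds_zero_nat (𝕜 := ℝ))
    refine tendsto_of_tendsto_of_tendsto_of_le_of_le tendsto_const_nhds h0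
      (fun n => zero_le) fun n => ?_
    dsimp only
    rw [← ofReal_measureReal (hfin n).ne, ← ENNReal.ofReal_mul (by positivity)]
    refine ENNReal.ofReal_le_ofReal ?_
    set v := ν.real (spanningSets ν n ∩ {p | H p ≤ n})
    have hv0 : 0 ≤ v := measureReal_nonneg
    have hv : v ≤ ⌈v⌉₊ + 1 := (Nat.le_ceil v).trans (by linarith)
    push_cast
    rw [div_mul_eq_mul_div, one_mul, div_le_div_iff₀ (by positivity) (by positivity), one_mul,
      mul_comm v]
    gcongr

end Quantization

/-- Convexity gives `(a + b) ^ α ≤ 2 ^ (α - 1) * (a ^ α + b ^ α)` with `2 ^ (α - 1) ≤ 2`, and `ε ^ α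
≤ ε` because `ε ≤ 1 ≤ α`. The error is thus linear in `ε`, uniformly in `α`. -/
theorem lintegral_rpow_le_of_le_add_indicator {E : Type*} [MeasurableSpace E] {ν : Measure E}
    {α : ℝ} (hα : α ∈ Icc (1 : ℝ) 2) {y ε : ℝ} (hy : 0 < y) (hε0 : 0 ≤ ε) (hε1 : ε ≤ 1)
    {B : Set E} (hB : MeasurableSet B) {W D : E → ℝ} (hW : ∀ p, 0 ≤ W p) (hD : ∀ p, 0 ≤ D p)
    (hWD : ∀ p, W p ≤ D p + B.indicator (fun _ => ε) p) :
    ∫⁻ p, ENNReal.ofReal ((W p / y) ^ α) ∂ν ≤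
      2 * (∫⁻ p, ENNReal.ofReal ((D p / y) ^ α) ∂ν +
        ENNReal.ofReal (y ^ (-α)) * (ENNReal.ofReal ε * ν B)) := by
  have hα0 : 0 ≤ α := zero_le_one.trans hα.1
  have key : ∀ p, ENNReal.ofReal ((W p / y) ^ α) ≤ 2 * (ENNReal.ofReal ((D p / y) ^ α) +
      B.indicator (fun _ => ENNReal.ofReal (y ^ (-α)) * ENNReal.ofReal ε) p) := by
    intro p
    set I : ℝ := B.indicator (fun _ => ε) p
    have hI0 : 0 ≤ I := indicator_nonneg (fun _ _ => hε0) p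
    have hI1 : ENNReal.ofReal ((I / y) ^ α) ≤
        B.indicator (fun _ => ENNReal.ofReal (y ^ (-α)) * ENNReal.ofReal ε) p := by
      by_cases hp : p ∈ B
      · simp only [I, indicator_of_mem hp]
        rw [← ENNReal.ofReal_mul (by positivity)]
        refine ENNReal.ofReal_le_ofReal ?_
        rw [Real.div_rpow hε0 hy.le, Real.rpow_neg hy.le, div_eq_inv_mul]
        have := Real.rpow_le_rpow_of_exponent_ge' hε0 hε1 zero_le_one hα.1
        rw [Real.rpow_one] at this
        gcongr
      · simp only [I, indicator_of_notMem hp]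
        rw [zero_div, Real.zero_rpow (by linarith [hα.1]), ENNReal.ofReal_zero]
    calc ENNReal.ofReal ((W p / y) ^ α) ≤ ENNReal.ofReal ((D p / y + I / y) ^ α) := by
          refine ENNReal.ofReal_le_ofReal (Real.rpow_le_rpow (div_nonneg (hW p) hy.le) ?_ hα0)
          rw [← add_div]
          exact div_le_div_of_nonneg_right (hWD p) hy.le
      _ = (ENNReal.ofReal (D p / y) + ENNReal.ofReal (I / y)) ^ α := by
          rw [← ENNReal.ofReal_add (div_nonneg (hD p) hy.le) (div_nonneg hI0 hy.le),
            ENNReal.ofReal_rpow_of_nonneg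
              (add_nonneg (div_nonneg (hD p) hy.le) (div_nonneg hI0 hy.le)) hα0]
      _ ≤ 2 ^ (α - 1) * (ENNReal.ofReal (D p / y) ^ α + ENNReal.ofReal (I / y) ^ α) :=
          ENNReal.rpow_add_le_mul_rpow_add_rpow _ _ hα.1
      _ ≤ 2 * (ENNReal.ofReal ((D p / y) ^ α) + ENNReal.ofReal ((I / y) ^ α)) := by
          rw [ENNReal.ofReal_rpow_of_nonneg (div_nonneg (hD p) hy.le) hα0,
            ENNReal.ofReal_rpow_of_nonneg (div_nonneg hI0 hy.le) hα0]
          gcongr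
          calc (2 : ℝ≥0∞) ^ (α - 1) ≤ 2 ^ (1 : ℝ) :=
                ENNReal.rpow_le_rpow_of_exponent_le (by norm_num) (by linarith [hα.2])
            _ = 2 := ENNReal.rpow_one 2
      _ ≤ _ := by gcongr
  refine (lintegral_mono key).trans (le_of_eq ?_)
  rw [lintegral_const_mul' _ _ (by norm_num),
    lintegral_add_right _ (measurable_const.indicator hB), lintegral_indicator_const hB, mul_assoc]

/-! ### Passage to the limit in probability. -/

section Limit

variable {Ω E : Type*} [MeasurableSpace Ω] [MeasurableSpace E] {P : Measure Ω}
  {N : Ω → Measure E} {ν : Measure E}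

theorem IsPoissonRandomMeasure.elementaryCompensatedIntegral_sub_ae_eq {F : Type*}
    [NormedAddCommGroup F] (hN : IsPoissonRandomMeasure P N ν) (S : SimpleFunc E F)
    (hS : ∀ c ≠ 0, ν (S ⁻¹' {c}) ≠ ∞) {g h : F → ℝ} (hg : g 0 = 0) (hh : h 0 = 0) :
    elementaryCompensatedIntegral N ν (fun p => g (S p) - h (S p)) =ᵐ[P] fun ω =>
      elementaryCompensatedIntegral N ν (fun p => g (S p)) ω -
        elementaryCompensatedIntegral N ν (fun p => h (S p)) ω := by
  filter_upwards [hN.elementaryCompensatedIntegral_comp_ae_eq S hS hg,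
    hN.elementaryCompensatedIntegral_comp_ae_eq S hS hh,
    hN.elementaryCompensatedIntegral_comp_ae_eq S hS (g := fun c => g c - h c)
      (by simp [hg, hh])] with ω h1 h2 h3
  rw [h1, h2, h3, ← Finset.sum_sub_distrib]
  exact Finset.sum_congr rfl fun c _ => sub_mul _ _ _

/-- Each difference involves two approximation errors; when both are below `y`, the threshold drops
from `4 * y` to `2 * y`. -/
theorem measure_lt_min_abs_sub_le_add {Y₁ Y₂ Y₃ I₁ I₂ I₃ : Ω → ℝ} {y : ℝ} :
    P {ω | 4 * y < min |Y₁ ω - Y₂ ω| |Y₂ ω - Y₃ ω|} ≤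
      P {ω | 2 * y ≤ min |I₁ ω - I₂ ω| |I₂ ω - I₃ ω|} +
        (P {ω | ENNReal.ofReal y ≤ edist (I₁ ω) (Y₁ ω)} +
          (P {ω | ENNReal.ofReal y ≤ edist (I₂ ω) (Y₂ ω)} +
            P {ω | ENNReal.ofReal y ≤ edist (I₃ ω) (Y₃ ω)})) := by
  refine le_trans (measure_mono ?_) ((measure_union_le _ _).trans (add_le_add le_rfl
    ((measure_union_le _ _).trans (add_le_add le_rfl (measure_union_le _ _)))))
  intro ω hω
  simp only [mem_ofPred_eq, mem_union, edist_dist, lt_min_iff, le_min_iff, Real.dist_eq] at hω ⊢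
  by_contra! hcon
  obtain ⟨h0, h1, h2, h3⟩ := hcon
  have h1 := (ENNReal.ofReal_lt_ofReal_iff'.1 h1).1
  have h2 := (ENNReal.ofReal_lt_ofReal_iff'.1 h2).1
  have h3 := (ENNReal.ofReal_lt_ofReal_iff'.1 h3).1
  have h4 : ∀ {u v u' v' : ℝ}, |u' - u| < y → |v' - v| < y → 4 * y < |u - v| →
      2 * y ≤ |u' - v'| := by
    intro u v u' v' hu hv huv
    have e : u - v = (u' - v') + (v' - v) - (u' - u) := by ring
    have := abs_sub ((u' - v') + (v' - v)) (u' - u)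
    have := abs_add_le (u' - v') (v' - v)
    rw [e] at huv
    linarith
  exact absurd (h4 h2 h3 hω.2) (not_le.2 (h0 (h4 h1 h2 hω.1)))

theorem IsPoissonRandomMeasure.measure_lt_min_abs_sub_le_of_ne_top [IsProbabilityMeasure P]
    [SigmaFinite ν] (hN : IsPoissonRandomMeasure P N ν) {H₁ H₂ H₃ : E → ℝ}
    (hm₁ : Measurable H₁) (hm₂ : Measurable H₂) (hm₃ : Measurable H₃)
    (h0₁ : ∀ p, 0 ≤ H₁ p) (h0₂ : ∀ p, 0 ≤ H₂ p) (h0₃ : ∀ p, 0 ≤ H₃ p) {Y₁ Y₂ Y₃ : Ω → ℝ}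
    (hY₁ : IsCompensatedIntegral P N ν H₁ Y₁) (hY₂ : IsCompensatedIntegral P N ν H₂ Y₂)
    (hY₃ : IsCompensatedIntegral P N ν H₃ Y₃) {α : ℝ} (hα : α ∈ Icc (1 : ℝ) 2) {y : ℝ}
    (hy : 0 < y)
    (hfin₁ : ∫⁻ p, ENNReal.ofReal ((|H₁ p - H₂ p| / y) ^ α) ∂ν ≠ ∞)
    (hfin₂ : ∫⁻ p, ENNReal.ofReal ((|H₂ p - H₃ p| / y) ^ α) ∂ν ≠ ∞) :
    P {ω | 4 * y < min |Y₁ ω - Y₂ ω| |Y₂ ω - Y₃ ω|} ≤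
      (8 * ∫⁻ p, ENNReal.ofReal ((|H₁ p - H₂ p| / y) ^ α) ∂ν) *
        (8 * ∫⁻ p, ENNReal.ofReal ((|H₂ p - H₃ p| / y) ^ α) ∂ν) +
      8 * ∫⁻ p, ENNReal.ofReal ((min |H₁ p - H₂ p| |H₂ p - H₃ p| / y) ^ α) ∂ν := by
  obtain ⟨B, k, hB, hνB, hBH, hBev, hk0, hk, hkB⟩ :=
    exists_quantization_scale ν ((hm₁.max hm₂).max hm₃)
  have hBH₁ : ∀ n, ∀ p ∈ B n, H₁ p ≤ n := fun n p hp =>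
    (le_max_left _ _).trans ((le_max_left _ _).trans (hBH n p hp))
  have hBH₂ : ∀ n, ∀ p ∈ B n, H₂ p ≤ n := fun n p hp =>
    (le_max_right _ _).trans ((le_max_left _ _).trans (hBH n p hp))
  have hBH₃ : ∀ n, ∀ p ∈ B n, H₃ p ≤ n := fun n p hp =>
    (le_max_right _ _).trans (hBH n p hp)
  have ht₁ := hY₁.tendsto _ (isAdmissibleApprox_indicator_quantize hm₁ h0₁ hB hνB hBH₁ hBev hk0 hk)
  have ht₂ := hY₂.tendsto _ (isAdmissibleApprox_indicator_quantize hm₂ h0₂ hB hνB hBH₂ hBev hk0 hk)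
  have ht₃ := hY₃.tendsto _ (isAdmissibleApprox_indicator_quantize hm₃ h0₃ hB hνB hBH₃ hBev hk0 hk)
  -- The triple is a single simple function, so all three approximations are sums over the same
  -- disjoint fibres.
  set S : ℕ → SimpleFunc E (ℝ × ℝ × ℝ) := fun n =>
    (quantizeSimpleFunc (k n) n hm₁ (hB n) (hBH₁ n)).pair
      ((quantizeSimpleFunc (k n) n hm₂ (hB n) (hBH₂ n)).pair
        (quantizeSimpleFunc (k n) n hm₃ (hB n) (hBH₃ n)))
  have hS₁ : ∀ n p, (S n p).1 = (B n).indicator (fun p => quantize (k n) (H₁ p)) p :=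
    fun _ _ => rfl
  have hS₂ : ∀ n p, (S n p).2.1 = (B n).indicator (fun p => quantize (k n) (H₂ p)) p :=
    fun _ _ => rfl
  have hS₃ : ∀ n p, (S n p).2.2 = (B n).indicator (fun p => quantize (k n) (H₃ p)) p :=
    fun _ _ => rfl
  have hSB : ∀ n p, p ∉ B n → S n p = 0 := fun n p hp =>
    Prod.ext ((hS₁ n p).trans (indicator_of_notMem hp _))
      (Prod.ext ((hS₂ n p).trans (indicator_of_notMem hp _))
        ((hS₃ n p).trans (indicator_of_notMem hp _)))
  have hSfin : ∀ n, ∀ c ≠ 0, ν (S n ⁻¹' {c}) ≠ ∞ := fun n c hc => by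
    refine ((measure_mono fun p hp => ?_).trans_lt (hνB n)).ne
    by_contra h
    exact hc (hp.symm.trans (hSB n p h))
  set I₁ : ℕ → Ω → ℝ := fun n => elementaryCompensatedIntegral N ν fun p => (S n p).1
  set I₂ : ℕ → Ω → ℝ := fun n => elementaryCompensatedIntegral N ν fun p => (S n p).2.1
  set I₃ : ℕ → Ω → ℝ := fun n => elementaryCompensatedIntegral N ν fun p => (S n p).2.2
  set η : ℕ → ℝ≥0∞ := fun n =>
    ENNReal.ofReal (y ^ (-α)) * (ENNReal.ofReal (1 / k n) * ν (B n))
  have hη : Tendsto η atTop (𝓝 0) := by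
    simpa only [mul_zero] using
      ENNReal.Tendsto.const_mul (a := ENNReal.ofReal (y ^ (-α))) hkB (.inr ENNReal.ofReal_ne_top)
  have hk1 : ∀ n, 1 / (k n : ℝ) ≤ 1 := fun n =>
    (div_le_one (Nat.cast_pos.2 (hk0 n))).2 (Nat.one_le_cast.2 (hk0 n))
  have hd₁ : ∀ n p, |(S n p).1 - (S n p).2.1| ≤
      |H₁ p - H₂ p| + (B n).indicator (fun _ => 1 / (k n : ℝ)) p := by
    intro n p
    by_cases hp : p ∈ B n
    · rw [hS₁, hS₂, indicator_of_mem hp, indicator_of_mem hp, indicator_of_mem hp]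
      exact abs_quantize_sub_quantize_le (hk0 n) (h0₁ p) (h0₂ p)
    · simp [hSB n p hp, indicator_of_notMem hp]
  have hd₂ : ∀ n p, |(S n p).2.1 - (S n p).2.2| ≤
      |H₂ p - H₃ p| + (B n).indicator (fun _ => 1 / (k n : ℝ)) p := by
    intro n p
    by_cases hp : p ∈ B n
    · rw [hS₂, hS₃, indicator_of_mem hp, indicator_of_mem hp, indicator_of_mem hp]
      exact abs_quantize_sub_quantize_le (hk0 n) (h0₂ p) (h0₃ p)
    · simp [hSB n p hp, indicator_of_notMem hp]
  have hbound : ∀ n, P {ω | 4 * y < min |Y₁ ω - Y₂ ω| |Y₂ ω - Y₃ ω|} ≤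
      (4 * (2 * (∫⁻ p, ENNReal.ofReal ((|H₁ p - H₂ p| / y) ^ α) ∂ν + η n))) *
        (4 * (2 * (∫⁻ p, ENNReal.ofReal ((|H₂ p - H₃ p| / y) ^ α) ∂ν + η n))) +
      4 * (2 * (∫⁻ p, ENNReal.ofReal ((min |H₁ p - H₂ p| |H₂ p - H₃ p| / y) ^ α) ∂ν + η n)) +
        (P {ω | ENNReal.ofReal y ≤ edist (I₁ n ω) (Y₁ ω)} +
          (P {ω | ENNReal.ofReal y ≤ edist (I₂ n ω) (Y₂ ω)} +
            P {ω | ENNReal.ofReal y ≤ edist (I₃ n ω) (Y₃ ω)})) := by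
    intro n
    refine measure_lt_min_abs_sub_le_add.trans (add_le_add ?_ le_rfl)
    have e₁ := hN.elementaryCompensatedIntegral_sub_ae_eq (S n) (hSfin n)
      (g := fun c => c.1) (h := fun c => c.2.1) rfl rfl
    have e₂ := hN.elementaryCompensatedIntegral_sub_ae_eq (S n) (hSfin n)
      (g := fun c => c.2.1) (h := fun c => c.2.2) rfl rfl
    have hε0 : 0 ≤ 1 / (k n : ℝ) := by positivity
    calc P {ω | 2 * y ≤ min |I₁ n ω - I₂ n ω| |I₂ n ω - I₃ n ω|}
        = P {ω | 2 * y ≤ min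
            |elementaryCompensatedIntegral N ν (fun p => (S n p).1 - (S n p).2.1) ω|
            |elementaryCompensatedIntegral N ν (fun p => (S n p).2.1 - (S n p).2.2) ω|} := by
          refine measure_congr ?_
          filter_upwards [e₁, e₂] with ω h1 h2
          refine propext ?_
          change 2 * y ≤ _ ↔ 2 * y ≤ _
          rw [h1, h2]
      _ ≤ _ := hN.measure_le_min_abs_elementary_le (S n) (hSfin n)
          (g := fun c => c.1 - c.2.1) (h := fun c => c.2.1 - c.2.2) (by simp) (by simp) hα hy
      _ ≤ _ := by
          gcongr
          · exact lintegral_rpow_le_of_le_add_indicator hα hy hε0 (hk1 n) (hB n)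
              (fun p => abs_nonneg _) (fun p => abs_nonneg _) (hd₁ n)
          · exact lintegral_rpow_le_of_le_add_indicator hα hy hε0 (hk1 n) (hB n)
              (fun p => abs_nonneg _) (fun p => abs_nonneg _) (hd₂ n)
          · refine lintegral_rpow_le_of_le_add_indicator hα hy hε0 (hk1 n) (hB n)
              (fun p => by positivity) (fun p => by positivity) fun p => ?_
            rw [← min_add_add_right]
            exact min_le_min (hd₁ n p) (hd₂ n p)
  refine (ge_of_tendsto' (x := atTop) (b := P {ω | 4 * y < min |Y₁ ω - Y₂ ω| |Y₂ ω - Y₃ ω|}) ?_ hbound).trans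
    (le_of_eq (add_zero _))
  have hyo : 0 < ENNReal.ofReal y := ENNReal.ofReal_pos.2 hy
  have hlim : ∀ a : ℝ≥0∞, Tendsto (fun n => 4 * (2 * (a + η n))) atTop (𝓝 (8 * a)) := by
    intro a
    have h1 : Tendsto (fun n => a + η n) atTop (𝓝 a) := by
      simpa using tendsto_const_nhds.add hη
    have := ENNReal.Tendsto.const_mul (a := 4)
      (ENNReal.Tendsto.const_mul (a := 2) h1 (.inr (by norm_num))) (.inr (by norm_num))
    rwa [← mul_assoc, show (4 : ℝ≥0∞) * 2 = 8 by norm_num] at this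
  -- Multiplication in `ℝ≥0∞` is discontinuous at `(0, ∞)`; finiteness of both factors avoids this.
  refine ((ENNReal.Tendsto.mul (hlim _) (.inr ?_) (hlim _) (.inr ?_)).add (hlim _)).add ?_
  · exact ENNReal.mul_ne_top (by norm_num) hfin₂
  · exact ENNReal.mul_ne_top (by norm_num) hfin₁
  · have h₁ : TendstoInMeasure P I₁ atTop Y₁ := ht₁
    have h₂ : TendstoInMeasure P I₂ atTop Y₂ := ht₂
    have h₃ : TendstoInMeasure P I₃ atTop Y₃ := ht₃
    simpa only [add_zero] using (h₁ _ hyo).add ((h₂ _ hyo).add (h₃ _ hyo))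

/-- The finiteness assumptions are removed. The delicate case is a product `0 * ∞`, where the
product term gives nothing and the event itself must be shown null. -/
theorem IsPoissonRandomMeasure.measure_lt_min_abs_sub_le [IsProbabilityMeasure P]
    [SigmaFinite ν] (hN : IsPoissonRandomMeasure P N ν) {H₁ H₂ H₃ : E → ℝ}
    (hm₁ : Measurable H₁) (hm₂ : Measurable H₂) (hm₃ : Measurable H₃)
    (h0₁ : ∀ p, 0 ≤ H₁ p) (h0₂ : ∀ p, 0 ≤ H₂ p) (h0₃ : ∀ p, 0 ≤ H₃ p) {Y₁ Y₂ Y₃ : Ω → ℝ}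
    (hY₁ : IsCompensatedIntegral P N ν H₁ Y₁) (hY₂ : IsCompensatedIntegral P N ν H₂ Y₂)
    (hY₃ : IsCompensatedIntegral P N ν H₃ Y₃) {α : ℝ} (hα : α ∈ Icc (1 : ℝ) 2) {y : ℝ}
    (hy : 0 < y) :
    P {ω | 4 * y < min |Y₁ ω - Y₂ ω| |Y₂ ω - Y₃ ω|} ≤
      (8 * ∫⁻ p, ENNReal.ofReal ((|H₁ p - H₂ p| / y) ^ α) ∂ν) *
        (8 * ∫⁻ p, ENNReal.ofReal ((|H₂ p - H₃ p| / y) ^ α) ∂ν) +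
      8 * ∫⁻ p, ENNReal.ofReal ((min |H₁ p - H₂ p| |H₂ p - H₃ p| / y) ^ α) ∂ν := by
  have hzero : ∀ {H G : E → ℝ} {Y X : Ω → ℝ}, Measurable H → Measurable G → (∀ p, 0 ≤ H p) →
      (∀ p, 0 ≤ G p) → IsCompensatedIntegral P N ν H Y → IsCompensatedIntegral P N ν G X →
      ∫⁻ p, ENNReal.ofReal ((|H p - G p| / y) ^ α) ∂ν = 0 → P {ω | 4 * y < |Y ω - X ω|} = 0 := by
    intro H G Y X hH hG hH0 hG0 hY hX h
    have h' : ∫⁻ p, ENNReal.ofReal ((|G p - H p| / y) ^ α) ∂ν = 0 := by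
      simpa only [abs_sub_comm] using h
    -- For the triple `H, G, H` the minimum is `|Y - X|` itself and every term of the bound
    -- vanishes.
    have := hN.measure_lt_min_abs_sub_le_of_ne_top hH hG hH hH0 hG0 hH0 hY hX hY hα hy
      (by simp [h]) (by simp [h'])
    have h'' : ∫⁻ p, ENNReal.ofReal ((min |H p - G p| |G p - H p| / y) ^ α) ∂ν = 0 := by
      simpa only [abs_sub_comm (G _) (H _), min_self] using h
    rw [h, h', h''] at this
    simpa [abs_sub_comm (X _) (Y _)] using this
  by_cases hz₁ : ∫⁻ p, ENNReal.ofReal ((|H₁ p - H₂ p| / y) ^ α) ∂ν = 0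
  · refine le_trans (le_of_eq (measure_mono_null (fun ω hω => ?_)
      (hzero hm₁ hm₂ h0₁ h0₂ hY₁ hY₂ hz₁))) zero_le
    have hω : 4 * y < min _ _ := hω
    exact (lt_min_iff.1 hω).1
  by_cases hz₂ : ∫⁻ p, ENNReal.ofReal ((|H₂ p - H₃ p| / y) ^ α) ∂ν = 0
  · refine le_trans (le_of_eq (measure_mono_null (fun ω hω => ?_)
      (hzero hm₂ hm₃ h0₂ h0₃ hY₂ hY₃ hz₂))) zero_le
    have hω : 4 * y < min _ _ := hω
    exact (lt_min_iff.1 hω).2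
  by_cases ht₁ : ∫⁻ p, ENNReal.ofReal ((|H₁ p - H₂ p| / y) ^ α) ∂ν = ∞
  · rw [ht₁, ENNReal.mul_top (by norm_num), ENNReal.top_mul (by simp [hz₂])]
    simp
  by_cases ht₂ : ∫⁻ p, ENNReal.ofReal ((|H₂ p - H₃ p| / y) ^ α) ∂ν = ∞
  · rw [ht₂, ENNReal.mul_top (by norm_num), ENNReal.mul_top (by simp [hz₁])]
    simp
  exact hN.measure_lt_min_abs_sub_le_of_ne_top hm₁ hm₂ hm₃ h0₁ h0₂ h0₃ hY₁ hY₂ hY₃ hα hy ht₁ ht₂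

end Limit

/-! ### Application to the mixed moving average. -/

/-- By Markov's inequality the superlevel sets of `min 1 (z ^ 2)` have finite mass, and they exhaust
the positive half-line. -/
theorem IsLevyMeasureOnPos.sigmaFinite {lam : Measure ℝ} (h : IsLevyMeasureOnPos lam) :
    SigmaFinite lam := by
  refine ⟨⟨⟨fun n => Iic 0 ∪ {z | ENNReal.ofReal (1 / ((n : ℝ) + 1)) ≤
    ENNReal.ofReal (min 1 (z ^ 2))}, fun _ => mem_univ _, fun n => ?_, ?_⟩⟩⟩
  · refine (measure_union_le _ _).trans_lt ?_
    rw [h.concentrated, zero_add]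
    have hpos : ENNReal.ofReal (1 / ((n : ℝ) + 1)) ≠ 0 :=
      (ENNReal.ofReal_pos.2 (by positivity)).ne'
    exact (meas_ge_le_lintegral_div (by fun_prop) hpos ENNReal.ofReal_ne_top).trans_lt
      (ENNReal.div_lt_top h.integrable.ne hpos)
  · refine eq_univ_of_forall fun z => mem_iUnion.2 ?_
    rcases le_or_gt z 0 with hz | hz
    · exact ⟨0, Or.inl hz⟩
    · obtain ⟨n, hn⟩ := exists_nat_one_div_lt (show 0 < min 1 (z ^ 2) by positivity)
      exact ⟨n, Or.inr (ENNReal.ofReal_le_ofReal hn.le)⟩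

theorem lintegral_jumpIntensity_rpow {V : Type*} [MeasurableSpace V] {pi : Measure V}
    [SFinite pi] {lam : Measure ℝ} [SFinite lam] {α : ℝ} (hα : 0 < α) {y : ℝ} (hy : 0 < y)
    {w : V × ℝ → ℝ} (hw : Measurable w) (hw0 : ∀ q, 0 ≤ w q) :
    ∫⁻ p, ENNReal.ofReal ((w (p.1, p.2.1) * (Ioc (0 : ℝ) 1).indicator (fun z => z) p.2.2 / y) ^ α)
        ∂(jumpIntensity pi lam) =
      ENNReal.ofReal (y ^ (-α)) * (∫⁻ z in Ioc (0 : ℝ) 1, ENNReal.ofReal (z ^ α) ∂lam) *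
        ∫⁻ q, ENNReal.ofReal (w q ^ α) ∂(pi.prod volume) := by
  have hind : Measurable ((Ioc (0 : ℝ) 1).indicator fun z => z) :=
    measurable_id.indicator measurableSet_Ioc
  have hind0 : ∀ z, 0 ≤ (Ioc (0 : ℝ) 1).indicator (fun z => z) z := fun z =>
    indicator_nonneg (fun z hz => hz.1.le) z
  rw [jumpIntensity, ← (measurePreserving_prodAssoc pi volume lam).lintegral_comp (by fun_prop)]
  have hpt : ∀ r : (V × ℝ) × ℝ, ENNReal.ofReal
      ((w r.1 * (Ioc (0 : ℝ) 1).indicator (fun z => z) r.2 / y) ^ α) =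
      ENNReal.ofReal (y ^ (-α)) * (ENNReal.ofReal (w r.1 ^ α) *
        (Ioc (0 : ℝ) 1).indicator (fun z => ENNReal.ofReal (z ^ α)) r.2) := by
    intro r
    have h1 : (Ioc (0 : ℝ) 1).indicator (fun z => ENNReal.ofReal (z ^ α)) r.2 =
        ENNReal.ofReal ((Ioc (0 : ℝ) 1).indicator (fun z => z) r.2 ^ α) := by
      by_cases hr : r.2 ∈ Ioc (0 : ℝ) 1
      · rw [indicator_of_mem hr, indicator_of_mem hr]
      · rw [indicator_of_notMem hr, indicator_of_notMem hr, Real.zero_rpow hα.ne',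
          ENNReal.ofReal_zero]
    rw [h1, ← ENNReal.ofReal_mul (Real.rpow_nonneg (hw0 _) _),
      ← ENNReal.ofReal_mul (by positivity), ← Real.mul_rpow (hw0 _) (hind0 _),
      Real.div_rpow (mul_nonneg (hw0 _) (hind0 _)) hy.le, Real.rpow_neg hy.le, div_eq_inv_mul]
  change ∫⁻ r : (V × ℝ) × ℝ, ENNReal.ofReal
      ((w r.1 * (Ioc (0 : ℝ) 1).indicator (fun z => z) r.2 / y) ^ α) ∂_ = _
  simp_rw [hpt]
  rw [lintegral_const_mul' _ _ ENNReal.ofReal_ne_top,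
    lintegral_prod_mul (f := fun q => ENNReal.ofReal (w q ^ α))
      (g := (Ioc (0 : ℝ) 1).indicator fun z => ENNReal.ofReal (z ^ α)) (by fun_prop)
      ((by fun_prop : Measurable fun z : ℝ => ENNReal.ofReal (z ^ α)).indicator
        measurableSet_Ioc).aemeasurable,
    lintegral_indicator measurableSet_Ioc]
  ring

theorem measure_lt_min_abs_sub_smallJumpMMA_le {Ω V : Type*} [MeasurableSpace Ω]
    [MeasurableSpace V] {P : Measure Ω} [IsProbabilityMeasure P] {pi : Measure V} [SigmaFinite pi]
    {lam : Measure ℝ} (hlam : IsLevyMeasureOnPos lam) {N : Ω → Measure (V × ℝ × ℝ)}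
    (hN : IsPoissonRandomMeasure P N (jumpIntensity pi lam)) {f : V → ℝ → ℝ}
    (hf : Measurable (Function.uncurry f)) (hf0 : ∀ x u, 0 ≤ f x u) {X₁ : ℝ → Ω → ℝ}
    (hX : IsSmallJumpMMA P N pi lam f X₁) {α : ℝ} (hα : α ∈ Icc (1 : ℝ) 2) {y : ℝ} (hy : 0 < y)
    (r s t : ℝ) :
    P {ω | 4 * y < min |X₁ t ω - X₁ s ω| |X₁ s ω - X₁ r ω|} ≤
      (8 * (ENNReal.ofReal (y ^ (-α)) * (∫⁻ z in Ioc (0 : ℝ) 1, ENNReal.ofReal (z ^ α) ∂lam) *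
        ∫⁻ p : V × ℝ, ENNReal.ofReal (|f p.1 (t - p.2) - f p.1 (s - p.2)| ^ α)
          ∂(pi.prod volume))) *
      (8 * (ENNReal.ofReal (y ^ (-α)) * (∫⁻ z in Ioc (0 : ℝ) 1, ENNReal.ofReal (z ^ α) ∂lam) *
        ∫⁻ p : V × ℝ, ENNReal.ofReal (|f p.1 (s - p.2) - f p.1 (r - p.2)| ^ α)
          ∂(pi.prod volume))) +
      8 * (ENNReal.ofReal (y ^ (-α)) * (∫⁻ z in Ioc (0 : ℝ) 1, ENNReal.ofReal (z ^ α) ∂lam) *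
        ∫⁻ p : V × ℝ, ENNReal.ofReal ((min |f p.1 (t - p.2) - f p.1 (s - p.2)|
          |f p.1 (s - p.2) - f p.1 (r - p.2)|) ^ α) ∂(pi.prod volume)) := by
  have := hlam.sigmaFinite
  have : SigmaFinite (jumpIntensity pi lam) := by unfold jumpIntensity; infer_instance
  have hα0 : 0 < α := zero_lt_one.trans_le hα.1
  have hind : Measurable ((Ioc (0 : ℝ) 1).indicator fun z => z) :=
    measurable_id.indicator measurableSet_Ioc
  have hind0 : ∀ z, 0 ≤ (Ioc (0 : ℝ) 1).indicator (fun z => z) z := fun z =>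
    indicator_nonneg (fun z hz => hz.1.le) z
  have hft : ∀ v : ℝ, Measurable fun q : V × ℝ => f q.1 (v - q.2) := fun v =>
    hf.comp (measurable_fst.prodMk (measurable_snd.const_sub v))
  have hHm : ∀ v : ℝ, Measurable fun p : V × ℝ × ℝ =>
      f p.1 (v - p.2.1) * (Ioc (0 : ℝ) 1).indicator (fun z => z) p.2.2 := fun v =>
    ((hft v).comp (measurable_fst.prodMk (measurable_fst.comp measurable_snd))).mul
      (hind.comp (measurable_snd.comp measurable_snd))
  have hH0 : ∀ (v : ℝ) (p : V × ℝ × ℝ),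
      0 ≤ f p.1 (v - p.2.1) * (Ioc (0 : ℝ) 1).indicator (fun z => z) p.2.2 := fun v p =>
    mul_nonneg (hf0 _ _) (hind0 _)
  have key := hN.measure_lt_min_abs_sub_le (hHm t) (hHm s) (hHm r) (hH0 t) (hH0 s) (hH0 r)
    (hX t) (hX s) (hX r) hα hy
  -- The three kernels share the nonnegative jump factor, which comes out of the differences and of
  -- their minimum.
  simp_rw [← sub_mul, abs_mul, abs_of_nonneg (hind0 _), ← min_mul_of_nonneg _ _ (hind0 _)] at key
  rwa [lintegral_jumpIntensity_rpow (w := fun q => |f q.1 (t - q.2) - f q.1 (s - q.2)|)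
      hα0 hy ((hft t).sub (hft s)).abs fun q => abs_nonneg _,
    lintegral_jumpIntensity_rpow (w := fun q => |f q.1 (s - q.2) - f q.1 (r - q.2)|)
      hα0 hy ((hft s).sub (hft r)).abs fun q => abs_nonneg _,
    lintegral_jumpIntensity_rpow (w := fun q => min |f q.1 (t - q.2) - f q.1 (s - q.2)|
      |f q.1 (s - q.2) - f q.1 (r - q.2)|) hα0 hy
      (((hft t).sub (hft s)).abs.min ((hft s).sub (hft r)).abs)
      fun q => le_min (abs_nonneg _) (abs_nonneg _)] at key

theorem mainTheorem3 (α : ℝ) (hα : α ∈ Set.Icc (1 : ℝ) 2) :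
    ∃ C : ℝ, 0 < C ∧
      ∀ {Ω V : Type*} [MeasurableSpace Ω] [TopologicalSpace V] [MeasurableSpace V] [BorelSpace V]
        (P : Measure Ω) [IsProbabilityMeasure P]
        (pi : Measure V) [SigmaFinite pi]
        (lam : Measure ℝ) (_hlam : IsLevyMeasureOnPos lam)
        (N : Ω → Measure (V × ℝ × ℝ))
        (_hN : IsPoissonRandomMeasure P N (jumpIntensity pi lam))
        (f : V → ℝ → ℝ) (_hf : Measurable (Function.uncurry f)) (_hf0 : ∀ x u, 0 ≤ f x u)
        (X₁ : ℝ → Ω → ℝ) (_hX : IsSmallJumpMMA P N pi lam f X₁)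
        (y s t : ℝ) (_hy : 0 < y) (_hs : 0 ≤ s) (_hst : s < t),
        P {ω | y < min |X₁ t ω - X₁ s ω| |X₁ s ω - X₁ 0 ω|} ≤
          ENNReal.ofReal (C * y ^ (-2 * α)) *
              (∫⁻ z in Set.Ioc (0 : ℝ) 1, ENNReal.ofReal (z ^ α) ∂lam) ^ 2 *
              (∫⁻ p : V × ℝ, ENNReal.ofReal (|f p.1 (t - p.2) - f p.1 (s - p.2)| ^ α)
                ∂(pi.prod volume)) *
              (∫⁻ p : V × ℝ, ENNReal.ofReal (|f p.1 (s - p.2) - f p.1 (-p.2)| ^ α)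
                ∂(pi.prod volume)) +
            ENNReal.ofReal (C * y ^ (-α)) *
              (∫⁻ z in Set.Ioc (0 : ℝ) 1, ENNReal.ofReal (z ^ α) ∂lam) *
              (∫⁻ p : V × ℝ,
                ENNReal.ofReal ((min |f p.1 (t - p.2) - f p.1 (s - p.2)|
                  |f p.1 (s - p.2) - f p.1 (-p.2)|) ^ α) ∂(pi.prod volume)) := by
  -- Replacing `y` by `y / 4` costs `4 ^ α ≤ 16` per factor `y ^ (-α)`, so the product term needs
  -- `(8 * 16) ^ 2 = 16384`; the other term needs only `8 * 16 = 128`.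
  refine ⟨16384, by norm_num, ?_⟩
  intro Ω V _ _ _ _ P _ pi _ lam hlam N hN f hf hf0 X₁ hX y s t hy _ _
  have key := measure_lt_min_abs_sub_smallJumpMMA_le hlam hN hf hf0 hX hα
    (show 0 < y / 4 by positivity) 0 s t
  rw [mul_div_cancel₀ y (by norm_num : (4 : ℝ) ≠ 0)] at key
  simp only [zero_sub] at key
  refine key.trans ?_
  have h4 : (y / 4) ^ (-α) ≤ 16 * y ^ (-α) := by
    rw [Real.div_rpow hy.le (by norm_num), div_eq_inv_mul, ← Real.rpow_neg (by norm_num), neg_neg]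
    gcongr
    calc (4 : ℝ) ^ α ≤ 4 ^ (2 : ℝ) := Real.rpow_le_rpow_of_exponent_le (by norm_num) hα.2
      _ = 16 := by norm_num
  have hc : ENNReal.ofReal ((y / 4) ^ (-α)) ≤ 16 * ENNReal.ofReal (y ^ (-α)) := by
    refine (ENNReal.ofReal_le_ofReal h4).trans (le_of_eq ?_)
    rw [ENNReal.ofReal_mul (by norm_num), ENNReal.ofReal_ofNat]
  have h2 : ENNReal.ofReal (16384 * y ^ (-2 * α)) =
      16384 * (ENNReal.ofReal (y ^ (-α)) * ENNReal.ofReal (y ^ (-α))) := by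
    rw [← ENNReal.ofReal_mul (by positivity), ← Real.rpow_add hy,
      ENNReal.ofReal_mul (by norm_num), ENNReal.ofReal_ofNat]
    ring_nf
  have h1 : ENNReal.ofReal (16384 * y ^ (-α)) = 16384 * ENNReal.ofReal (y ^ (-α)) := by
    rw [ENNReal.ofReal_mul (by norm_num), ENNReal.ofReal_ofNat]
  rw [h1, h2]
  set c := ENNReal.ofReal (y ^ (-α))
  generalize (∫⁻ z in Ioc (0 : ℝ) 1, ENNReal.ofReal (z ^ α) ∂lam) = L
  generalize (∫⁻ p : V × ℝ, ENNReal.ofReal (|f p.1 (t - p.2) - f p.1 (s - p.2)| ^ α)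
    ∂(pi.prod volume)) = B₁
  generalize (∫⁻ p : V × ℝ, ENNReal.ofReal (|f p.1 (s - p.2) - f p.1 (-p.2)| ^ α)
    ∂(pi.prod volume)) = B₂
  generalize (∫⁻ p : V × ℝ, ENNReal.ofReal ((min |f p.1 (t - p.2) - f p.1 (s - p.2)|
    |f p.1 (s - p.2) - f p.1 (-p.2)|) ^ α) ∂(pi.prod volume)) = B₃
  calc _ ≤ 8 * (16 * c * L * B₁) * (8 * (16 * c * L * B₂)) + 8 * (16 * c * L * B₃) := by gcongr
    _ = 16384 * (c * c) * L ^ 2 * B₁ * B₂ + 128 * c * L * B₃ := by ring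
    _ ≤ _ := by gcongr; norm_num
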